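/- Graphs are finite, simple and undirected. For a graph $G$ on $n$ vertices without isolated vertices and $\alpha\in[0,1)$, the PageRank of $G$ with damping factor $\alpha$ is the row vector $(1-\alpha)\,\mathbf v\,(1-\alpha\bar G)^{-1}$, where $\bar G$ is the row-normalized adjacency matrix of $G$ and $\mathbf v=\frac1n\mathbf 1$ is the uniform preference vector. A centrality $c$ is score monotone on $G$ if for every two distinct non-adjacent vertices $x,y$ of $G$ one has $c_G(x)<c_{G'}(x)$ and $c_G(y)<c_{G'}(y)$, where $G'$ is $G$ with the new edge $x\,\text{—}\,y$ added. For $k\ge 1$ let $G_k$ be the following connected graph with $2k+6$ vertices. It has one vertex labeled $i$ for each $i\in\{0,1,2,3,5,6,7\}$, $k$ vertices labeled $4$, and $k-1$ vertices labeled $8$. Vertex $3$ and the $k$ vertices labeled $4$ form a $(k+1)$-clique; vertices $0$, $7$ and the $k-1$ vertices labeled $8$ form a $(k+1)$-clique; the remaining edges are those of the paths $1\,\text{—}\,2\,\text{—}\,3$ and $3\,\text{—}\,5\,\text{—}\,6\,\text{—}\,7$. Let $G_k'$ be $G_k$ with the new edge $0\,\text{—}\,1$ added. **Theorem.** For every $\alpha\in(0,1)$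 there is a $K$ such that for all $k\ge K$ PageRank with damping factor $\alpha$ is not score monotone on $G_k$. More precisely (bottom violation), vertices $0$ and $1$ are distinct and non-adjacent in $G_k$, the PageRank of $1$ in $G_k$ is strictly smaller than that of $0$ in $G_k$, and the PageRank of $1$ in $G_k'$ is strictly smaller than the PageRank of $1$ in $G_k$. -/

import Mathlib

/-- `G` with the new edge between `x` and `y` added. -/
def addEdge {V : Type*} (G : SimpleGraph V) (x y : V) : SimpleGraph V :=
  G ⊔ SimpleGraph.edge x y

/-- A centrality `c` (assigning a real score to every vertex of every graph on `V`) is score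
monotone on `G` if adding an edge between any two distinct non-adjacent vertices strictly
increases the scores of both endpoints. -/
def ScoreMonotoneOn {V : Type*} (c : SimpleGraph V → V → ℝ) (G : SimpleGraph V) : Prop :=
  ∀ x y : V, x ≠ y → ¬ G.Adj x y →
    c G x < c (addEdge G x y) x ∧ c G y < c (addEdge G x y) y

open Classical in
/-- The row-normalized adjacency matrix: null rows, if any, are left untouched. -/
noncomputable def normalizedAdj {V : Type*} [Fintype V] (G : SimpleGraph V) : Matrix V V ℝ :=
  Matrix.of fun x y => G.adjMatrix ℝ x y / ∑ z, G.adjMatrix ℝ x z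

/-- The PageRank (row) vector `(1 - α) v (1 - α Ḡ)⁻¹` with damping factor `α` and preference
vector `v`, for graphs without isolated vertices and `0 ≤ α < 1`; the matrix is then invertible,
see `isUnit_det_one_sub_smul_normalizedAdj`. -/
noncomputable def pageRankWith {V : Type*} [Fintype V] [DecidableEq V] (α : ℝ) (v : V → ℝ)
    (G : SimpleGraph V) : V → ℝ :=
  (1 - α) • Matrix.vecMul v (1 - α • normalizedAdj G)⁻¹

/-- PageRank with damping factor `α` and uniform preference vector. -/
noncomputable def pageRank {V : Type*} [Fintype V] [DecidableEq V] (α : ℝ)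
    (G : SimpleGraph V) : V → ℝ :=
  pageRankWith α (fun _ => 1 / (Fintype.card V : ℝ)) G

/-- The matrix inverted in the definition of PageRank is invertible for `0 ≤ α < 1`. -/
theorem isUnit_det_one_sub_smul_normalizedAdj {V : Type*} [Fintype V] [DecidableEq V]
    (G : SimpleGraph V) (α : ℝ) (h0 : 0 ≤ α) (h1 : α < 1) :
    IsUnit (1 - α • normalizedAdj G).det := by
  classical
  have hnn : ∀ x y, 0 ≤ normalizedAdj G x y := fun x y => by
    simp only [normalizedAdj, Matrix.of_apply]
    refine div_nonneg ?_ (Finset.sum_nonneg fun z _ => ?_) <;>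
      · simp only [SimpleGraph.adjMatrix_apply]
        split_ifs <;> norm_num
  have hsum : ∀ x, ∑ y, normalizedAdj G x y ≤ 1 := fun x => by
    simp only [normalizedAdj, Matrix.of_apply, ← Finset.sum_div]
    exact div_self_le_one _
  have hd : ∀ x, normalizedAdj G x x = 0 := fun x => by simp [normalizedAdj]
  refine isUnit_iff_ne_zero.2 (det_ne_zero_of_sum_row_lt_diag fun x => ?_)
  have h2 : ∑ y ∈ Finset.univ.erase x, ‖(1 - α • normalizedAdj G) x y‖
      = ∑ y ∈ Finset.univ.erase x, α * normalizedAdj G x y := by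
    refine Finset.sum_congr rfl fun y hy => ?_
    have : x ≠ y := (Finset.ne_of_mem_erase hy).symm
    simp [Matrix.sub_apply, Matrix.one_apply_ne this, abs_of_nonneg h0, abs_of_nonneg (hnn x y)]
  have h3 : ∑ y ∈ Finset.univ.erase x, normalizedAdj G x y ≤ 1 :=
    (Finset.sum_le_sum_of_subset_of_nonneg (Finset.erase_subset _ _)
      fun y _ _ => hnn x y).trans (hsum x)
  have h4 : ‖(1 - α • normalizedAdj G) x x‖ = 1 := by simp [hd]
  rw [h2, ← Finset.mul_sum, h4]
  nlinarith

/-- The number of vertices of `G_k` with a given label: `k` with label `4`, `k - 1` with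
label `8` (for `k ≥ 1`), and one with each of the other labels. -/
def fiberSize (k : ℕ) : Fin 9 → ℕ := ![1, 1, 1, 1, k, 1, 1, 1, k - 1]

/-- The vertices of `G_k`: a label together with an index among the vertices with that label. -/
abbrev PRVertex (k : ℕ) : Type := Σ i : Fin 9, Fin (fiberSize k i)

/-- The pairs of labels carried by edges of `G_k`: the `(k+1)`-clique on `3` and the `4`s;
the `(k+1)`-clique on `0`, `7` and the `8`s; and the paths `1 — 2 — 3` and
`3 — 5 — 6 — 7`. -/
def prLabelEdges : List (Fin 9 × Fin 9) :=
  [(3, 4), (4, 4), (0, 7), (0, 8), (7, 8), (8, 8), (1, 2), (2, 3), (3, 5), (5, 6), (6, 7)]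

/-- The graph `G_k`: two distinct vertices are adjacent exactly when their labels are listed,
in one order or the other, in `prLabelEdges`. -/
def prGraph (k : ℕ) : SimpleGraph (PRVertex k) :=
  SimpleGraph.fromRel fun x y => (x.1, y.1) ∈ prLabelEdges

/-- The vertex of `G_k` labeled `0`. -/
def prVertex0 (k : ℕ) : PRVertex k := ⟨0, (0 : Fin 1)⟩

/-- The vertex of `G_k` labeled `1`. -/
def prVertex1 (k : ℕ) : PRVertex k := ⟨1, (0 : Fin 1)⟩

/-!
Write `d` for the degrees of a graph without isolated vertices, `n` for the number of its vertices
and `Ḡ` for its row-normalized adjacency matrix. Put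
`PageRank(y) = (1 - α) / n * d y * r y`; then `r` solves the linear system
`d y * r y = 1 + α * ∑_{x ~ y} r x`. This system obeys a comparison principle: a function `s` that
satisfies it with `≥` (a supersolution) bounds PageRank from above, and one that satisfies it with
`≤` (a subsolution) bounds it from below (`pageRank_le_of_supersolution`,
`le_pageRank_of_subsolution`). The reason is that `u ≥ α • (u ᵥ* Ḡ)` forces `u ≥ 0`, since `Ḡ` is
substochastic (`nonneg_of_smul_vecMul_le`).

For large `k` the vertices `0`, `3`, `4`, `7`, `8` have large degree, so `r` is small there and the
ends `1` and `2` of the path `1 — 2 — 3` hardly feel the rest of the graph. Up to the factor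
`(1 - α) / n` and in the limit, the score of `1` in `G_k` is `(2 + α) / (2 - α ^ 2)`, its score in
`G_k'` is `2 / (2 - α)`, and the score of `0` in `G_k` is `1 / (1 - α)`; for `0 < α < 1`
these satisfy `2 / (2 - α) < (2 + α) / (2 - α ^ 2) < 1 / (1 - α)`. Functions constant on labels,
with the value `α / 4` on the vertices of large degree, are super- and subsolutions for large `k`
precise enough to separate the three scores.
-/

open Finset

/-! ### A comparison principle for PageRank -/

open Classical in
/-- The sum of `s` over the neighbors of `y`; for `s = 1` it is the degree of `y`. -/
noncomputable def nbrSum {V : Type*} [Fintype V] (G : SimpleGraph V) (s : V → ℝ) (y : V) : ℝ :=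
  ∑ x, if G.Adj y x then s x else 0

section Comparison

variable {V : Type*} [Fintype V]

open Classical in
theorem normalizedAdj_apply (G : SimpleGraph V) (x y : V) :
    normalizedAdj G x y = (if G.Adj x y then 1 else 0) / nbrSum G (fun _ => 1) x := by
  simp [normalizedAdj, nbrSum, SimpleGraph.adjMatrix_apply]

theorem nbrSum_one_nonneg (G : SimpleGraph V) (x : V) : 0 ≤ nbrSum G (fun _ => 1) x :=
  sum_nonneg fun _ _ => by split_ifs <;> norm_num

theorem nbrSum_one_pos_of_adj {G : SimpleGraph V} {x y : V} (h : G.Adj x y) :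
    0 < nbrSum G (fun _ => 1) x :=
  sum_pos' (fun _ _ => by split_ifs <;> norm_num) ⟨y, mem_univ y, by simp [h]⟩

theorem normalizedAdj_nonneg (G : SimpleGraph V) (x y : V) : 0 ≤ normalizedAdj G x y := by
  classical
  rw [normalizedAdj_apply]
  exact div_nonneg (by split_ifs <;> norm_num) (nbrSum_one_nonneg G x)

theorem sum_normalizedAdj_le_one (G : SimpleGraph V) (x : V) :
    ∑ y, normalizedAdj G x y ≤ 1 := by
  classical
  simp only [normalizedAdj_apply, ← sum_div]
  exact div_self_le_one _

/-- Multiplying by the degrees undoes the row normalization. -/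
theorem vecMul_normalizedAdj (G : SimpleGraph V) (s : V → ℝ) (y : V) :
    Matrix.vecMul (fun x => nbrSum G (fun _ => 1) x * s x) (normalizedAdj G) y
      = nbrSum G s y := by
  classical
  simp only [Matrix.vecMul, dotProduct, normalizedAdj_apply]
  refine sum_congr rfl fun x _ => ?_
  by_cases h : G.Adj x y
  · have := (nbrSum_one_pos_of_adj h).ne'
    simp only [h, h.symm, if_true]
    field_simp
  · simp [h, show ¬ G.Adj y x from fun hyx => h hyx.symm]

/-- The minimum principle behind the comparison: summing the negative parts of both sides shows
that their total is at most `α` times itself. -/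
theorem nonneg_of_smul_vecMul_le (G : SimpleGraph V) {α : ℝ} (h0 : 0 ≤ α) (h1 : α < 1)
    {u : V → ℝ} (hu : ∀ y, α * Matrix.vecMul u (normalizedAdj G) y ≤ u y) (y : V) : 0 ≤ u y := by
  have hneg : ∀ y, max (-u y) 0 ≤ α * ∑ x, max (-u x) 0 * normalizedAdj G x y := fun y => by
    refine max_le ?_ (mul_nonneg h0 (sum_nonneg fun x _ =>
      mul_nonneg (le_max_right _ _) (normalizedAdj_nonneg G x y)))
    have hsum : -∑ x, u x * normalizedAdj G x y ≤ ∑ x, max (-u x) 0 * normalizedAdj G x y := by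
      rw [← sum_neg_distrib]
      refine sum_le_sum fun x _ => ?_
      rw [← neg_mul]
      exact mul_le_mul_of_nonneg_right (le_max_left _ _) (normalizedAdj_nonneg G x y)
    have huy := hu y
    simp only [Matrix.vecMul, dotProduct] at huy
    nlinarith
  have htotal : ∑ y, max (-u y) 0 ≤ α * ∑ x, max (-u x) 0 := by
    refine (sum_le_sum fun y _ => hneg y).trans ?_
    rw [← mul_sum, sum_comm]
    refine mul_le_mul_of_nonneg_left (sum_le_sum fun x _ => ?_) h0
    rw [← mul_sum]
    exact mul_le_of_le_one_right (le_max_right _ _) (sum_normalizedAdj_le_one G x)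
  have hy : max (-u y) 0 ≤ ∑ x, max (-u x) 0 :=
    single_le_sum (f := fun x => max (-u x) 0) (fun x _ => le_max_right _ _) (mem_univ y)
  have := le_max_left (-u y) 0
  nlinarith

variable [DecidableEq V]

/-- The fixed-point equation of PageRank. -/
theorem pageRank_eq (G : SimpleGraph V) {α : ℝ} (h0 : 0 ≤ α) (h1 : α < 1) (y : V) :
    pageRank α G y = (1 - α) / Fintype.card V
      + α * Matrix.vecMul (pageRank α G) (normalizedAdj G) y := by
  have h : Matrix.vecMul (pageRank α G) (1 - α • normalizedAdj G)
      = (1 - α) • fun _ => 1 / (Fintype.card V : ℝ) := by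
    rw [pageRank, pageRankWith, Matrix.smul_vecMul, Matrix.vecMul_vecMul,
      Matrix.nonsing_inv_mul _ (isUnit_det_one_sub_smul_normalizedAdj G α h0 h1),
      Matrix.vecMul_one]
  have hy := congrFun h y
  simp only [Matrix.vecMul_sub, Matrix.vecMul_one, Matrix.vecMul_smul, Pi.sub_apply,
    Pi.smul_apply, smul_eq_mul] at hy
  linear_combination hy

theorem pageRank_le_of_supersolution (G : SimpleGraph V) {α : ℝ} (h0 : 0 ≤ α) (h1 : α < 1)
    {s : V → ℝ} (hs : ∀ y, 1 + α * nbrSum G s y ≤ nbrSum G (fun _ => 1) y * s y) (y : V) :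
    pageRank α G y ≤ (1 - α) / Fintype.card V * (nbrSum G (fun _ => 1) y * s y) := by
  have hc : 0 ≤ (1 - α) / (Fintype.card V : ℝ) :=
    div_nonneg (sub_nonneg.2 h1.le) (Nat.cast_nonneg _)
  refine sub_nonneg.1 (nonneg_of_smul_vecMul_le G h0 h1
    (u := ((1 - α) / (Fintype.card V : ℝ)) • (fun x => nbrSum G (fun _ => 1) x * s x)
      - pageRank α G) (fun y => ?_) y)
  rw [Matrix.sub_vecMul, Matrix.smul_vecMul]
  simp only [Pi.sub_apply, Pi.smul_apply, smul_eq_mul, vecMul_normalizedAdj]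
  linear_combination ((1 - α) / (Fintype.card V : ℝ)) * hs y + pageRank_eq G h0 h1 y

theorem le_pageRank_of_subsolution (G : SimpleGraph V) {α : ℝ} (h0 : 0 ≤ α) (h1 : α < 1)
    {s : V → ℝ} (hs : ∀ y, nbrSum G (fun _ => 1) y * s y ≤ 1 + α * nbrSum G s y) (y : V) :
    (1 - α) / Fintype.card V * (nbrSum G (fun _ => 1) y * s y) ≤ pageRank α G y := by
  have hc : 0 ≤ (1 - α) / (Fintype.card V : ℝ) :=
    div_nonneg (sub_nonneg.2 h1.le) (Nat.cast_nonneg _)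
  refine sub_nonneg.1 (nonneg_of_smul_vecMul_le G h0 h1
    (u := pageRank α G
      - ((1 - α) / (Fintype.card V : ℝ)) • (fun x => nbrSum G (fun _ => 1) x * s x))
    (fun y => ?_) y)
  rw [Matrix.sub_vecMul, Matrix.smul_vecMul]
  simp only [Pi.sub_apply, Pi.smul_apply, smul_eq_mul, vecMul_normalizedAdj]
  linear_combination ((1 - α) / (Fintype.card V : ℝ)) * hs y - pageRank_eq G h0 h1 y

theorem nbrSum_addEdge (G : SimpleGraph V) {x y : V} (hne : x ≠ y)
    (hxy : ¬ G.Adj x y) (s : V → ℝ) (z : V) :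
    nbrSum (addEdge G x y) s z
      = nbrSum G s z + (if z = x then s y else 0) + (if z = y then s x else 0) := by
  classical
  have hyx : ¬ G.Adj y x := fun h => hxy h.symm
  have hpt : ∀ w, (if (addEdge G x y).Adj z w then s w else 0)
      = (if G.Adj z w then s w else 0) + (if w = y then (if z = x then s y else 0) else 0)
        + (if w = x then (if z = y then s x else 0) else 0) := fun w => by
    simp only [addEdge, SimpleGraph.sup_adj, SimpleGraph.edge_adj]
    by_cases hzx : z = x <;> by_cases hzy : z = y <;> by_cases hwx : w = x <;>
      by_cases hwy : w = y <;> subst_vars <;> simp_all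
  simp only [nbrSum, hpt, sum_add_distrib, sum_ite_eq', mem_univ, if_true]

end Comparison

/-! ### Neighborhoods in `G_k` -/

/-- Label `i` is joined to label `j`, in one order or the other, in `G_k`. -/
abbrev LabelAdj (i j : Fin 9) : Prop := (i, j) ∈ prLabelEdges ∨ (j, i) ∈ prLabelEdges

/-- The sum over the neighbors of a vertex labeled `i` in `G_k` of a function `f` of the label;
the last term removes the vertex itself, when its label is joined to itself. -/
def labelSum (k : ℕ) (f : Fin 9 → ℝ) (i : Fin 9) : ℝ :=
  (∑ j, if LabelAdj i j then fiberSize k j * f j else 0) - if LabelAdj i i then f i else 0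

theorem prGraph_adj {k : ℕ} {x y : PRVertex k} :
    (prGraph k).Adj x y ↔ x ≠ y ∧ LabelAdj x.1 y.1 := by
  simp [prGraph, SimpleGraph.fromRel_adj]

theorem nbrSum_prGraph (k : ℕ) (f : Fin 9 → ℝ) (y : PRVertex k) :
    nbrSum (prGraph k) (fun x => f x.1) y = labelSum k f y.1 := by
  classical
  have hpt : ∀ x : PRVertex k, (if (prGraph k).Adj y x then f x.1 else 0)
      = (if LabelAdj y.1 x.1 then f x.1 else 0)
        - (if x = y then (if LabelAdj y.1 y.1 then f y.1 else 0) else 0) := fun x => by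
    rw [prGraph_adj]
    by_cases h : x = y
    · subst h; simp
    · simp [h, Ne.symm h]
  simp only [nbrSum, hpt, sum_sub_distrib, sum_ite_eq', mem_univ, if_true, labelSum,
    Fintype.sum_sigma, sum_const, card_univ, Fintype.card_fin, nsmul_eq_mul, mul_ite, mul_zero]

theorem labelSum_eq {k : ℕ} (hk : 1 ≤ k) (f : Fin 9 → ℝ) :
    labelSum k f = ![f 7 + (k - 1) * f 8, f 2, f 1 + f 3, f 2 + k * f 4 + f 5,
      f 3 + (k - 1) * f 4, f 3 + f 6, f 5 + f 7, f 0 + f 6 + (k - 1) * f 8,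
      f 0 + f 7 + (k - 2) * f 8] := by
  funext i
  fin_cases i <;>
    simp [labelSum, LabelAdj, prLabelEdges, Fin.sum_univ_succ, fiberSize, Nat.cast_sub hk] <;>
    ring

theorem prVertex_eq_iff {k : ℕ} (z : PRVertex k) :
    (z = prVertex0 k ↔ z.1 = 0) ∧ (z = prVertex1 k ↔ z.1 = 1) := by
  obtain ⟨i, j⟩ := z
  constructor <;> refine ⟨fun h => congrArg Sigma.fst h, fun h => ?_⟩ <;>
    · dsimp only at h
      subst h
      exact congrArg _ (Subsingleton.elim (α := Fin 1) _ _)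

theorem prVertex0_ne_prVertex1 (k : ℕ) : prVertex0 k ≠ prVertex1 k := fun h => by
  simpa [prVertex0, prVertex1] using congrArg Sigma.fst h

theorem not_adj_prVertex0_prVertex1 (k : ℕ) :
    ¬ (prGraph k).Adj (prVertex0 k) (prVertex1 k) := by
  rw [prGraph_adj]
  simp [prVertex0, prVertex1, prLabelEdges, LabelAdj]

theorem nbrSum_addEdge_prGraph (k : ℕ) (f : Fin 9 → ℝ) (y : PRVertex k) :
    nbrSum (addEdge (prGraph k) (prVertex0 k) (prVertex1 k)) (fun x => f x.1) y
      = labelSum k f y.1 + (if y.1 = 0 then f 1 else 0) + (if y.1 = 1 then f 0 else 0) := by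
  rw [nbrSum_addEdge _ (prVertex0_ne_prVertex1 k) (not_adj_prVertex0_prVertex1 k),
    nbrSum_prGraph]
  simp only [(prVertex_eq_iff y).1, (prVertex_eq_iff y).2]
  rfl

/-! ### Bounds on the scores of `0` and `1` -/

/-- The supersolution has the value `α / 4` at the vertices of large degree, and elsewhere the
values that solve the equations exactly. The bound on `k` makes `α / 4` sufficient at `3` and `7`,
the vertices of large degree with neighbors outside the cliques. -/
theorem pageRank_prVertex1_le {α : ℝ} (h0 : 0 < α) (h1 : α < 1) {k : ℕ} (hk : 1 ≤ k)
    (hkα : 5 ≤ k * ((1 - α) * (α / 4))) :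
    pageRank α (prGraph k) (prVertex1 k) ≤ (1 - α) / Fintype.card (PRVertex k)
      * ((2 + α + α ^ 3 / 4) / (2 - α ^ 2)) := by
  have hd : 0 < 2 - α ^ 2 := by nlinarith
  have hd' : 0 < 2 - α := by linarith
  obtain ⟨a, ha⟩ : ∃ a, a = (2 + α + α ^ 3 / 4) / (2 - α ^ 2) := ⟨_, rfl⟩
  obtain ⟨b, hb⟩ : ∃ b, b = (1 + α + α ^ 2 / 4) / (2 - α ^ 2) := ⟨_, rfl⟩
  obtain ⟨t, ht⟩ : ∃ t, t = (1 + α ^ 2 / 4) / (2 - α) := ⟨_, rfl⟩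
  have hab : a = 1 + α * b := by rw [ha, hb]; field_simp; ring
  have hba : 2 * b = 1 + α * (a + α / 4) := by rw [ha, hb]; field_simp; ring
  have htt : (2 - α) * t = 1 + α ^ 2 / 4 := by rw [ht]; field_simp
  have hb3 : b ≤ 5 / 2 := by rw [hb, div_le_iff₀ hd]; nlinarith
  have ht2 : t ≤ 3 / 2 := by rw [ht, div_le_iff₀ hd']; nlinarith
  have hαb : α * b ≤ 5 / 2 := by nlinarith
  have hαt : α * t ≤ 3 / 2 := by nlinarith
  rw [← ha]
  have h := pageRank_le_of_supersolution (prGraph k) h0.le h1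
    (s := fun x => (![α / 4, a, b, α / 4, α / 4, t, t, α / 4, α / 4] : Fin 9 → ℝ) x.1)
    (fun y => ?_) (prVertex1 k)
  · rw [nbrSum_prGraph k (fun _ => 1), labelSum_eq hk] at h
    simpa [prVertex1] using h
  · rw [nbrSum_prGraph, nbrSum_prGraph k (fun _ => 1), labelSum_eq hk, labelSum_eq hk]
    generalize y.1 = i
    fin_cases i <;> simp <;> nlinarith

/-- The supersolution has the value `α / 4` at the vertices of large degree. The paths `1 — 2` and
`5 — 6` now both have two ends attached to such vertices, so one value `t` with
`2 * t = 1 + α * (t + α / 4)` is exact on all four. -/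
theorem pageRank_addEdge_prVertex1_le {α : ℝ} (h0 : 0 < α) (h1 : α < 1) {k : ℕ} (hk : 1 ≤ k)
    (hkα : 5 ≤ k * ((1 - α) * (α / 4))) :
    pageRank α (addEdge (prGraph k) (prVertex0 k) (prVertex1 k)) (prVertex1 k)
      ≤ (1 - α) / Fintype.card (PRVertex k) * (2 * ((1 + α ^ 2 / 4) / (2 - α))) := by
  have hd : 0 < 2 - α := by linarith
  obtain ⟨t, ht⟩ : ∃ t, t = (1 + α ^ 2 / 4) / (2 - α) := ⟨_, rfl⟩
  have htt : (2 - α) * t = 1 + α ^ 2 / 4 := by rw [ht]; field_simp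
  have ht2 : t ≤ 3 / 2 := by rw [ht, div_le_iff₀ hd]; nlinarith
  have hαt : α * t ≤ 3 / 2 := by nlinarith
  rw [← ht]
  have h := pageRank_le_of_supersolution
    (addEdge (prGraph k) (prVertex0 k) (prVertex1 k)) h0.le h1
    (s := fun x => (![α / 4, t, t, α / 4, α / 4, t, t, α / 4, α / 4] : Fin 9 → ℝ) x.1)
    (fun y => ?_) (prVertex1 k)
  · rw [nbrSum_addEdge_prGraph k (fun _ => 1), labelSum_eq hk] at h
    simpa [prVertex1, one_add_one_eq_two] using h
  · rw [nbrSum_addEdge_prGraph, nbrSum_addEdge_prGraph k (fun _ => 1), labelSum_eq hk,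
      labelSum_eq hk]
    generalize y.1 = i
    fin_cases i <;> simp <;> nlinarith

/-- The subsolution lives on `1` and `2`, where it is exact for the value `0` at `3`, and on the
clique of `0`, `7` and the vertices labeled `8`, where it is constant. -/
theorem le_pageRank_prGraph {α : ℝ} (h0 : 0 < α) (h1 : α < 1) {k : ℕ} (hk : 1 ≤ k) :
    (1 - α) / Fintype.card (PRVertex k) * ((2 + α) / (2 - α ^ 2))
        ≤ pageRank α (prGraph k) (prVertex1 k) ∧
      (1 - α) / Fintype.card (PRVertex k) * (k / (k * (1 - α) + 1))
        ≤ pageRank α (prGraph k) (prVertex0 k) := by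
  have hd : 0 < 2 - α ^ 2 := by nlinarith
  have hk0 : (1 : ℝ) ≤ k := by exact_mod_cast hk
  have hd' : 0 < k * (1 - α) + 1 := by nlinarith
  obtain ⟨a, ha⟩ : ∃ a, a = (2 + α) / (2 - α ^ 2) := ⟨_, rfl⟩
  obtain ⟨b, hb⟩ : ∃ b, b = (1 + α) / (2 - α ^ 2) := ⟨_, rfl⟩
  obtain ⟨c, hc⟩ : ∃ c, c = 1 / (k * (1 - α) + 1) := ⟨_, rfl⟩
  have hab : a = 1 + α * b := by rw [ha, hb]; field_simp; ring
  have hba : 2 * b = 1 + α * a := by rw [ha, hb]; field_simp; ring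
  have hcc : c * (k * (1 - α) + 1) = 1 := by rw [hc]; field_simp
  have hb0 : 0 < α * b := by rw [hb]; positivity
  have hc0 : 0 < c := by rw [hc]; positivity
  have hαc : 0 < α * c := by positivity
  have h := le_pageRank_of_subsolution (prGraph k) h0.le h1
    (s := fun x => (![c, a, b, 0, 0, 0, 0, c, c] : Fin 9 → ℝ) x.1) (fun y => ?_)
  · have hv1 := h (prVertex1 k)
    have hv0 := h (prVertex0 k)
    rw [nbrSum_prGraph k (fun _ => 1), labelSum_eq hk] at hv1 hv0
    rw [← ha, div_eq_mul_one_div (k : ℝ), ← hc]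
    constructor
    · simpa [prVertex1] using hv1
    · simpa [prVertex0] using hv0
  · rw [nbrSum_prGraph, nbrSum_prGraph k (fun _ => 1), labelSum_eq hk, labelSum_eq hk]
    generalize y.1 = i
    fin_cases i <;> simp <;> nlinarith

/-! ### Comparison of the scores -/

theorem mainTheorem6 (α : ℝ) (hα0 : 0 < α) (hα1 : α < 1) :
    ∃ K : ℕ, ∀ k : ℕ, K ≤ k →
      ¬ ScoreMonotoneOn (pageRank α) (prGraph k) ∧
      prVertex0 k ≠ prVertex1 k ∧
      ¬ (prGraph k).Adj (prVertex0 k) (prVertex1 k) ∧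
      pageRank α (prGraph k) (prVertex1 k) < pageRank α (prGraph k) (prVertex0 k) ∧
      pageRank α (addEdge (prGraph k) (prVertex0 k) (prVertex1 k)) (prVertex1 k) <
        pageRank α (prGraph k) (prVertex1 k) := by
  have hd : 0 < 2 - α ^ 2 := by nlinarith
  have hd' : 0 < 2 - α := by linarith
  obtain ⟨a, ha⟩ : ∃ a, a = (2 + α + α ^ 3 / 4) / (2 - α ^ 2) := ⟨_, rfl⟩
  have ha1 : 0 < 1 - a * (1 - α) := by
    have : a * (1 - α) < 1 := by
      rw [ha, div_mul_eq_mul_div, div_lt_one hd]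
      have : 0 < α ^ 3 := by positivity
      have : α ^ 3 < α := by nlinarith
      nlinarith
    linarith
  have hm : 0 < (1 - α) * (α / 4) := mul_pos (by linarith) (by linarith)
  -- The first bound serves the supersolutions; the second makes `a < k / (k * (1 - α) + 1)`.
  obtain ⟨K₁, hK₁⟩ := exists_nat_ge (5 / ((1 - α) * (α / 4)))
  obtain ⟨K₂, hK₂⟩ := exists_nat_gt (a / (1 - a * (1 - α)))
  refine ⟨max 1 (max K₁ K₂), fun k hkK => ?_⟩
  simp only [max_le_iff] at hkK
  obtain ⟨hk, hk₁, hk₂⟩ := hkK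
  have hk0 : (1 : ℝ) ≤ k := by exact_mod_cast hk
  have hkα : 5 ≤ k * ((1 - α) * (α / 4)) :=
    (div_le_iff₀ hm).1 (hK₁.trans (by exact_mod_cast hk₁))
  have hka : a < k * (1 - a * (1 - α)) :=
    (div_lt_iff₀ ha1).1 (hK₂.trans_le (by exact_mod_cast hk₂))
  have hc : 0 < (1 - α) / (Fintype.card (PRVertex k) : ℝ) :=
    div_pos (by linarith) (Nat.cast_pos.2 (Fintype.card_pos_iff.2 ⟨prVertex0 k⟩))
  obtain ⟨hlow1, hlow0⟩ := le_pageRank_prGraph hα0 hα1 hk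
  have hlt : pageRank α (prGraph k) (prVertex1 k) < pageRank α (prGraph k) (prVertex0 k) := by
    refine (pageRank_prVertex1_le hα0 hα1 hk hkα).trans_lt
      ((mul_lt_mul_of_pos_left ?_ hc).trans_le hlow0)
    rw [← ha, lt_div_iff₀ (by nlinarith)]
    linarith
  have hdrop : pageRank α (addEdge (prGraph k) (prVertex0 k) (prVertex1 k)) (prVertex1 k) <
      pageRank α (prGraph k) (prVertex1 k) := by
    refine (pageRank_addEdge_prVertex1_le hα0 hα1 hk hkα).trans_lt
      ((mul_lt_mul_of_pos_left ?_ hc).trans_le hlow1)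
    rw [← mul_div_assoc, div_lt_div_iff₀ hd' hd]
    have : 0 < α ^ 4 := by positivity
    nlinarith
  have hne := prVertex0_ne_prVertex1 k
  have hadj := not_adj_prVertex0_prVertex1 k
  exact ⟨fun hmono => lt_asymm hdrop (hmono _ _ hne hadj).2, hne, hadj, hlt, hdrop⟩
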